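/- Let $G$ be a topological group acting continuously from the left on a topological space $F$. A fiber bundle with fiber $F$ and structure group $G$ is a map $f\colon E\to M$ with local trivializations over an open cover $\{U_\alpha\}$ of $M$ whose changes of trivialization are given, through the action of $G$ on $F$, by continuous transition functions $g_{\alpha\beta}\colon U_\alpha\cap U_\beta\to G$ satisfying the cocycle condition; isomorphisms of such bundles are over the identity of $M$ and are given in local trivializations by continuous $G$-valued functions compatible with the transition functions. Such a bundle is numerable if it has a trivializing open cover with a subordinate locally finite partition of unity (automatic if $M$ is paracompact Hausdorff). Let $\alpha\colon EG\to BG=EG/G$ be Milnor's universal principal $G$-bundle ($EG$ is the infinite join $G*G*\cdots$ with right $G$-action, in the coarsest topology making the join coordinates $t_i\colon EG\to[0,1]$ and $g_i\colon t_i^{-1}((0,1])\to G$ continuous), and let $F_G=EG\times_G F$ be the homotopy quotient, i.e. the quotient of $EG\times F$ by the action $(e,x)\cdot g=(eg,g^{-1}x)$, with the projection $F_G\to BG$, $[e,x]\mapsto\alpha(e)$ and its bundle structure associated to $EG\to BG$. Then $F_G\to BG$ is a numerable fiber bundle with fiber $F$ and structure group $G$, and for every numerable fiber bundle $f\colon E\to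 M$ with fiber $F$ and structure group $G$ there is a continuous map $h\colon M\to BG$ such that $E$ is isomorphic, as a fiber bundle over $M$ with fiber $F$ and structure group $G$, to the pullback $h^*(F_G)$. In this sense $F_G\to BG$ is a universal bundle for numerable fiber bundles with fiber $F$ and structure group $G$. -/

import Mathlib

open Set Topology

universe u v w x y z w' x' z'

/-! ### Fiber bundles with a structure group -/

/-- A fiber bundle `f : E → M` with fiber `F` and structure group `G`, where `G` acts on `F` from
the left: a family of local trivializations `φ i : f ⁻¹ (U i) → U i × F` whose base sets `U i` form
an open cover of `M`, together with continuous transition functions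
`g i j : U i ∩ U j → G` which satisfy the cocycle condition and describe the changes of
trivialization through the action of `G` on `F`. (The action need not be effective, so that
the transition functions are part of the data. The values of `g i j` outside `U i ∩ U j`
are irrelevant.) -/
structure GBundle (G : Type u) [Group G] [TopologicalSpace G]
    (F : Type v) [TopologicalSpace F] [MulAction G F]
    {E : Type z} [TopologicalSpace E] {M : Type x} [TopologicalSpace M] (f : E → M) where
  /-- the index set of the cover -/
  ι : Type w
  /-- the local trivializations -/
  triv : ι → Bundle.Trivialization F f
  /-- the base sets cover the base space -/
  cover : ∀ m : M, ∃ i, m ∈ (triv i).baseSet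
  /-- the transition functions -/
  g : ι → ι → M → G
  continuousOn_g : ∀ i j, ContinuousOn (g i j) ((triv i).baseSet ∩ (triv j).baseSet)
  cocycle : ∀ i j k, ∀ m ∈ (triv i).baseSet ∩ (triv j).baseSet ∩ (triv k).baseSet,
    g i j m * g j k m = g i k m
  triv_eq : ∀ i j, ∀ p : E, f p ∈ (triv i).baseSet ∩ (triv j).baseSet →
    (triv i p).2 = g i j (f p) • (triv j p).2

namespace GBundle

section

variable {G : Type u} [Group G] [TopologicalSpace G] {F : Type v} [TopologicalSpace F]
  [MulAction G F] {E : Type z} [TopologicalSpace E] {M : Type x} [TopologicalSpace M] {f : E → M}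

/-- An isomorphism, over the identity of `M`, of fiber bundles over `M` with fiber `F` and
structure group `G`: a homeomorphism over `M` that in the local trivializations is given by
continuous functions `U' a ∩ U i → G`, compatibly with the transition functions on both sides. -/
structure Iso {E' : Type z'} [TopologicalSpace E'] {f' : E' → M}
    (B : GBundle.{u, v, w} G F f) (B' : GBundle.{u, v, w'} G F f') where
  toHomeomorph : E ≃ₜ E'
  proj_eq : ∀ p : E, f' (toHomeomorph p) = f p
  /-- the coordinate transformations -/
  coord : B'.ι → B.ι → M → G
  continuousOn_coord : ∀ a i,
    ContinuousOn (coord a i) ((B'.triv a).baseSet ∩ (B.triv i).baseSet)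
  coord_mul : ∀ a i j,
    ∀ m ∈ (B'.triv a).baseSet ∩ (B.triv i).baseSet ∩ (B.triv j).baseSet,
      coord a i m * B.g i j m = coord a j m
  mul_coord : ∀ a b i,
    ∀ m ∈ (B'.triv a).baseSet ∩ (B'.triv b).baseSet ∩ (B.triv i).baseSet,
      B'.g a b m * coord b i m = coord a i m
  triv_eq : ∀ a i, ∀ p : E, f p ∈ (B'.triv a).baseSet ∩ (B.triv i).baseSet →
    (B'.triv a (toHomeomorph p)).2 = coord a i (f p) • (B.triv i p).2

/-- The trivializing cover `U i` is numerable: it has a subordinate locally finite partition of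
unity. -/
def HasPartition (B : GBundle.{u, v, w} G F f) : Prop :=
  ∃ ρ : PartitionOfUnity B.ι M, ρ.IsSubordinate fun i => (B.triv i).baseSet

/-- A bundle with structure group `G` is numerable if, up to isomorphism (equivalently, up to
passing to another compatible family of local trivializations), it has a numerable trivializing
cover. This is automatic over a paracompact Hausdorff base. -/
def IsNumerable (B : GBundle.{u, v, w} G F f) : Prop :=
  ∃ B' : GBundle.{u, v, w} G F f, Nonempty (B.Iso B') ∧ B'.HasPartition

end

end GBundle

/-- A local trivialization of `f` over the open set `U`, assembled from its fiber coordinate `c`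
and its inverse `s`. -/
def mkTrivialization {F : Type v} [TopologicalSpace F] {E : Type z} [TopologicalSpace E]
    {M : Type x} [TopologicalSpace M] {f : E → M} (hf : Continuous f) (U : Set M) (hU : IsOpen U)
    (c : E → F) (hc : ContinuousOn c (f ⁻¹' U)) (s : M × F → E)
    (hs : ContinuousOn s (U ×ˢ (univ : Set F)))
    (hfs : ∀ m ∈ U, ∀ a, f (s (m, a)) = m) (hcs : ∀ m ∈ U, ∀ a, c (s (m, a)) = a)
    (hsc : ∀ p, f p ∈ U → s (f p, c p) = p) : Bundle.Trivialization F f where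
  toFun p := (f p, c p)
  invFun := s
  source := f ⁻¹' U
  target := U ×ˢ univ
  baseSet := U
  map_source' p hp := ⟨hp, mem_univ _⟩
  map_target' q hq := by
    change f (s (q.1, q.2)) ∈ U
    rw [hfs q.1 hq.1]; exact hq.1
  left_inv' p hp := hsc p hp
  right_inv' q hq := Prod.ext (hfs q.1 hq.1 q.2) (hcs q.1 hq.1 q.2)
  open_source := hU.preimage hf
  open_target := hU.prod isOpen_univ
  open_baseSet := hU
  continuousOn_toFun := hf.continuousOn.prodMk hc
  continuousOn_invFun := hs
  source_eq := rfl
  target_eq := rfl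
  proj_toFun _ _ := rfl

/-! ### Pullback of a bundle -/

/-- The total space `N ×_M E` of the pullback of `f : E → M` along `h : N → M`. -/
abbrev PullbackSpace {E : Type z} {M : Type x} {N : Type y} (h : N → M) (f : E → M) :
    Type (max y z) :=
  {p : N × E // h p.1 = f p.2}

/-- The projection `N ×_M E → N`. -/
def PullbackSpace.proj {E : Type z} {M : Type x} {N : Type y} (h : N → M) (f : E → M)
    (p : PullbackSpace h f) : N :=
  p.1.1

namespace GBundle

section

variable {G : Type u} [Group G] [TopologicalSpace G] {F : Type v} [TopologicalSpace F]
  [MulAction G F] {E : Type z} [TopologicalSpace E] {M : Type x} [TopologicalSpace M] {f : E → M}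
  {N : Type y} [TopologicalSpace N]

theorem exists_inverse (B : GBundle.{u, v, w} G F f) (h : C(N, M)) (i : B.ι) (q : N × F) :
    ∃ p : PullbackSpace h f, p.1.1 = q.1 ∧
      (h q.1 ∈ (B.triv i).baseSet → p.1.2 = (B.triv i).toOpenPartialHomeomorph.symm (h q.1, q.2)) := by
  by_cases hi : h q.1 ∈ (B.triv i).baseSet
  · exact ⟨⟨(q.1, (B.triv i).toOpenPartialHomeomorph.symm (h q.1, q.2)),
      ((B.triv i).proj_symm_apply' hi).symm⟩, rfl, fun _ => rfl⟩
  · obtain ⟨j, hj⟩ := B.cover (h q.1)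
    exact ⟨⟨(q.1, (B.triv j).toOpenPartialHomeomorph.symm (h q.1, q.2)),
      ((B.triv j).proj_symm_apply' hj).symm⟩, rfl, fun h' => absurd h' hi⟩

/-- The local trivialization `(n, p) ↦ (n, (φ i p).2)` of the pullback. -/
noncomputable def pullbackTriv (B : GBundle.{u, v, w} G F f) (h : C(N, M)) (i : B.ι) :
    Bundle.Trivialization F (PullbackSpace.proj h f) :=
  mkTrivialization (continuous_fst.comp continuous_subtype_val)
    (h ⁻¹' (B.triv i).baseSet) ((B.triv i).open_baseSet.preimage h.continuous)
    (fun p => (B.triv i p.1.2).2)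
    (by
      have h1 : ContinuousOn (fun p : PullbackSpace h f => p.1.2)
          (PullbackSpace.proj h f ⁻¹' (h ⁻¹' (B.triv i).baseSet)) :=
        (continuous_snd.comp continuous_subtype_val).continuousOn
      refine continuous_snd.comp_continuousOn
        (ContinuousOn.comp (B.triv i).toOpenPartialHomeomorph.continuousOn h1 ?_)
      intro p hp
      have hp' : h p.1.1 ∈ (B.triv i).baseSet := hp
      rw [p.2] at hp'
      exact (B.triv i).mem_source.2 hp')
    (fun q => (B.exists_inverse h i q).choose)
    (by
      refine (IsInducing.subtypeVal (t := {p : N × E | h p.1 = f p.2})).continuousOn_iff.2 ?_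
      have h1 : ContinuousOn (fun q : N × F =>
          (q.1, (B.triv i).toOpenPartialHomeomorph.symm (h q.1, q.2)))
          ((h ⁻¹' (B.triv i).baseSet) ×ˢ (univ : Set F)) := by
        have h2 : ContinuousOn (fun q : N × F => (h q.1, q.2))
            ((h ⁻¹' (B.triv i).baseSet) ×ˢ (univ : Set F)) :=
          ((h.continuous.comp continuous_fst).prodMk continuous_snd).continuousOn
        refine continuousOn_fst.prodMk
          (ContinuousOn.comp (B.triv i).toOpenPartialHomeomorph.continuousOn_symm h2 ?_)
        intro q hq
        exact (B.triv i).mem_target.2 hq.1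
      refine h1.congr fun q hq => ?_
      have := (B.exists_inverse h i q).choose_spec
      exact Prod.ext this.1 (this.2 hq.1))
    (fun n _ a => (B.exists_inverse h i (n, a)).choose_spec.1)
    (fun n hn a => by
      have := (B.exists_inverse h i (n, a)).choose_spec.2 hn
      simp only
      rw [this, (B.triv i).apply_symm_apply' hn])
    (fun p hp => by
      have hp' : h p.1.1 ∈ (B.triv i).baseSet := hp
      have hs := (B.exists_inverse h i (p.1.1, (B.triv i p.1.2).2)).choose_spec
      refine Subtype.ext (Prod.ext hs.1 ((hs.2 hp').trans ?_))
      have hp2 : f p.1.2 ∈ (B.triv i).baseSet := p.2 ▸ hp'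
      change (B.triv i).toOpenPartialHomeomorph.symm (h p.1.1, (B.triv i p.1.2).2) = p.1.2
      rw [p.2]
      exact (B.triv i).symm_apply_mk_proj ((B.triv i).mem_source.2 hp2))

/-- The pullback `h^* E → N`, as a bundle with fiber `F` and structure group `G`: its transition
functions are `g i j ∘ h`. -/
noncomputable def pullback (B : GBundle.{u, v, w} G F f) (h : C(N, M)) :
    GBundle.{u, v, w} G F (PullbackSpace.proj h f) where
  ι := B.ι
  triv := B.pullbackTriv h
  cover n := B.cover (h n)
  g i j n := B.g i j (h n)
  continuousOn_g i j := (B.continuousOn_g i j).comp h.continuous.continuousOn fun _ hn => hn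
  cocycle i j k n hn := B.cocycle i j k (h n) hn
  triv_eq i j p hp := by
    have hp' : h p.1.1 ∈ (B.triv i).baseSet ∩ (B.triv j).baseSet := hp
    have := B.triv_eq i j p.1.2 (p.2 ▸ hp')
    rw [← p.2] at this
    exact this

end

end GBundle

/-! ### Milnor's construction of `EG → BG` -/

/-- Milnor's total space `EG`, the infinite join `G * G * G * ⋯`: a point is a family of
barycentric coordinates `t i ≥ 0`, almost all zero and of sum `1`, together with an element
`g i` of `G` for every `i` with `t i > 0`. -/
structure MilnorE (G : Type u) where
  t : ℕ → ℝ
  t_nonneg : ∀ i, 0 ≤ t i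
  t_finite : (Function.support t).Finite
  t_sum : ∑ᶠ i, t i = 1
  g : ∀ i, 0 < t i → G

namespace MilnorE

section

variable {G : Type u}

/-- The topology of `EG`: the coarsest one for which all `t i : EG → ℝ` and all
`g i : {t i > 0} → G` are continuous and the sets `{t i > 0}` carry the subspace topology. -/
instance [TopologicalSpace G] : TopologicalSpace (MilnorE G) :=
  TopologicalSpace.generateFrom
    ({S | ∃ (i : ℕ) (U : Set ℝ), IsOpen U ∧ S = {e | e.t i ∈ U}} ∪
      {S | ∃ (i : ℕ) (V : Set G), IsOpen V ∧ S = {e | ∃ h : 0 < e.t i, e.g i h ∈ V}})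

theorem exists_pos (e : MilnorE G) : ∃ i, 0 < e.t i := by
  by_contra! hc
  have h0 : e.t = 0 := funext fun i => le_antisymm (hc i) (e.t_nonneg i)
  have := e.t_sum
  simp [h0] at this

theorem continuous_t [TopologicalSpace G] (i : ℕ) : Continuous fun e : MilnorE G => e.t i :=
  ⟨fun U hU => TopologicalSpace.isOpen_generateFrom_of_mem (Or.inl ⟨i, U, hU, rfl⟩)⟩

theorem isOpen_pos [TopologicalSpace G] (i : ℕ) : IsOpen {e : MilnorE G | 0 < e.t i} :=
  isOpen_lt continuous_const (continuous_t i)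

variable [Group G]

/-- The right action of `G` on `EG`, by right multiplication on all the `g i`. -/
def rmul (e : MilnorE G) (a : G) : MilnorE G where
  t := e.t
  t_nonneg := e.t_nonneg
  t_finite := e.t_finite
  t_sum := e.t_sum
  g i h := e.g i h * a

theorem rmul_one (e : MilnorE G) : e.rmul 1 = e := by
  cases e; simp [rmul]

theorem rmul_rmul (e : MilnorE G) (a b : G) : (e.rmul a).rmul b = e.rmul (a * b) := by
  cases e; simp [rmul, mul_assoc]

/-- The function `g i`, extended by `1` to all of `EG`. -/
noncomputable def coord (i : ℕ) (e : MilnorE G) : G :=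
  open Classical in if h : 0 < e.t i then e.g i h else 1

theorem coord_of_pos {i : ℕ} {e : MilnorE G} (h : 0 < e.t i) : coord i e = e.g i h := by
  simp [coord, h]

theorem coord_rmul {i : ℕ} {e : MilnorE G} (h : 0 < e.t i) (a : G) :
    coord i (e.rmul a) = coord i e * a := by
  have h' : 0 < (e.rmul a).t i := h
  rw [coord_of_pos h, coord_of_pos h']
  rfl

variable [TopologicalSpace G]

theorem continuousAt_coord {i : ℕ} {e : MilnorE G} (h : 0 < e.t i) :
    ContinuousAt (coord (G := G) i) e := by
  intro V hV
  obtain ⟨V', hV', hVo, hmem⟩ := mem_nhds_iff.1 hV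
  have ho : IsOpen {e : MilnorE G | ∃ h : 0 < e.t i, e.g i h ∈ V'} :=
    TopologicalSpace.isOpen_generateFrom_of_mem (Or.inr ⟨i, V', hVo, rfl⟩)
  rw [coord_of_pos h] at hmem
  refine Filter.mem_map.2 ?_
  filter_upwards [ho.mem_nhds ⟨h, hmem⟩] with e' he'
  obtain ⟨h', hm'⟩ := he'
  change coord i e' ∈ V
  rw [coord_of_pos h']
  exact hV' hm'

theorem continuousOn_rmul [IsTopologicalGroup G] {S : Set (MilnorE G)} {k : MilnorE G → G}
    (hk : ContinuousOn k S) : ContinuousOn (fun e => e.rmul (k e)) S := by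
  refine continuousOn_to_generateFrom_iff.2 fun e he T hT heT => ?_
  rcases hT with ⟨i, U, hU, rfl⟩ | ⟨i, V, hV, rfl⟩
  · exact mem_nhdsWithin_of_mem_nhds ((hU.preimage (continuous_t i)).mem_nhds heT)
  · obtain ⟨h, hm⟩ := heT
    have h0 : 0 < e.t i := h
    have hc : ContinuousWithinAt (fun e => coord i e * k e) S e :=
      (continuousAt_coord h0).continuousWithinAt.mul (hk e he)
    have hm' : coord i e * k e ∈ V := by rw [coord_of_pos h0]; exact hm
    filter_upwards [hc (hV.mem_nhds hm'),
      mem_nhdsWithin_of_mem_nhds ((isOpen_pos i).mem_nhds h0)] with e' h1 h2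
    have h2' : 0 < e'.t i := h2
    refine ⟨h2', ?_⟩
    have h1' : coord i e' * k e' ∈ V := h1
    rw [coord_of_pos h2'] at h1'
    exact h1'

/-- Two points of `EG` are equivalent if they lie in the same `G`-orbit. -/
def orbitSetoid (G : Type u) [Group G] : Setoid (MilnorE G) where
  r e e' := ∃ a : G, e' = e.rmul a
  iseqv :=
    { refl := fun e => ⟨1, (rmul_one e).symm⟩
      symm := by
        rintro e _ ⟨a, rfl⟩
        exact ⟨a⁻¹, by rw [rmul_rmul, mul_inv_cancel, rmul_one]⟩
      trans := by
        rintro e _ _ ⟨a, rfl⟩ ⟨b, rfl⟩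
        exact ⟨a * b, by rw [rmul_rmul]⟩ }

end

end MilnorE

/-- The classifying space `BG = EG / G`, with the quotient topology. -/
def MilnorB (G : Type u) [Group G] : Type u :=
  Quotient (MilnorE.orbitSetoid G)

/-- The diagonal action `(e, x) · a = (e a, a⁻¹ x)` of `G` on `EG × F`: two points are equivalent
if they lie in the same orbit. -/
def diagonalSetoid (G : Type u) [Group G] (F : Type v) [MulAction G F] :
    Setoid (MilnorE G × F) where
  r p q := ∃ a : G, q = (p.1.rmul a, a⁻¹ • p.2)
  iseqv :=
    { refl := fun p => ⟨1, by simp [MilnorE.rmul_one]⟩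
      symm := by
        rintro p _ ⟨a, rfl⟩
        exact ⟨a⁻¹, by simp [MilnorE.rmul_rmul, MilnorE.rmul_one]⟩
      trans := by
        rintro p _ _ ⟨a, rfl⟩ ⟨b, rfl⟩
        exact ⟨a * b, by simp [MilnorE.rmul_rmul, mul_smul]⟩ }

/-- The homotopy quotient `F_G = EG ×_G F`, with the quotient topology. -/
def HomotopyQuotient (G : Type u) [Group G] (F : Type v) [MulAction G F] : Type (max u v) :=
  Quotient (diagonalSetoid G F)

section

variable {G : Type u} [Group G] {F : Type v} [MulAction G F]

instance [TopologicalSpace G] : TopologicalSpace (MilnorB G) :=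
  inferInstanceAs (TopologicalSpace (Quotient (MilnorE.orbitSetoid G)))

instance [TopologicalSpace G] [TopologicalSpace F] : TopologicalSpace (HomotopyQuotient G F) :=
  inferInstanceAs (TopologicalSpace (Quotient (diagonalSetoid G F)))

/-- The projection `α : EG → BG`. -/
def MilnorB.mk (e : MilnorE G) : MilnorB G := Quotient.mk _ e

theorem MilnorB.mk_rmul (e : MilnorE G) (a : G) : MilnorB.mk (e.rmul a) = MilnorB.mk e :=
  (Quotient.sound (s := MilnorE.orbitSetoid G) ⟨a, rfl⟩).symm

theorem MilnorB.exists_of_mk_eq {e e' : MilnorE G} (h : MilnorB.mk e = MilnorB.mk e') :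
    ∃ a : G, e' = e.rmul a :=
  Quotient.exact (s := MilnorE.orbitSetoid G) h

/-- The class `[e, x]` in `F_G`. -/
def HomotopyQuotient.mk (p : MilnorE G × F) : HomotopyQuotient G F := Quotient.mk _ p

theorem HomotopyQuotient.mk_rmul (e : MilnorE G) (a : G) (x : F) :
    HomotopyQuotient.mk (e.rmul a, x) = HomotopyQuotient.mk (e, a • x) :=
  (Quotient.sound (s := diagonalSetoid G F) ⟨a, by simp⟩).symm

/-- The projection `F_G → BG`, `[e, x] ↦ α e`. -/
def HomotopyQuotient.proj (G : Type u) [Group G] (F : Type v) [MulAction G F] :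
    HomotopyQuotient G F → MilnorB G :=
  Quotient.lift (fun p => MilnorB.mk p.1) (by
    rintro p _ ⟨a, rfl⟩
    exact (MilnorB.mk_rmul p.1 a).symm)

/-- The barycentric coordinate `t n`, as a function on `BG`. -/
def MilnorB.t (n : ℕ) : MilnorB G → ℝ :=
  Quotient.lift (fun e => e.t n) (by rintro e _ ⟨a, rfl⟩; rfl)

/-- A representative in `EG` of a point of `BG`. -/
noncomputable def MilnorB.rep (b : MilnorB G) : MilnorE G :=
  Quotient.out (s := MilnorE.orbitSetoid G) b

theorem MilnorB.mk_rep (b : MilnorB G) : MilnorB.mk b.rep = b :=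
  Quotient.out_eq (s := MilnorE.orbitSetoid G) b

/-- The section of `EG → BG` over `{t n > 0}` whose `n`-th coordinate is `1`:
`[e] ↦ e · (g n e)⁻¹`. -/
noncomputable def MilnorB.sec (n : ℕ) (b : MilnorB G) : MilnorE G :=
  b.rep.rmul (MilnorE.coord n b.rep)⁻¹

theorem MilnorB.sec_mk {n : ℕ} {e : MilnorE G} (h : 0 < e.t n) :
    MilnorB.sec n (MilnorB.mk e) = e.rmul (MilnorE.coord n e)⁻¹ := by
  obtain ⟨a, ha⟩ := MilnorB.exists_of_mk_eq (MilnorB.mk_rep (MilnorB.mk e)).symm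
  rw [MilnorB.sec, ha, MilnorE.coord_rmul h, MilnorE.rmul_rmul]
  congr 1
  group

/-- The fiber coordinate `[e, x] ↦ g n e • x` on the part of `F_G` over `{t n > 0}`. -/
noncomputable def HomotopyQuotient.coord (n : ℕ) (q : HomotopyQuotient G F) : F :=
  MilnorE.coord n (Quotient.out (s := diagonalSetoid G F) q).1 •
    (Quotient.out (s := diagonalSetoid G F) q).2

theorem HomotopyQuotient.coord_mk {n : ℕ} {e : MilnorE G} (h : 0 < e.t n) (x : F) :
    HomotopyQuotient.coord n (HomotopyQuotient.mk (e, x)) = MilnorE.coord n e • x := by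
  obtain ⟨a, ha⟩ := Quotient.exact (s := diagonalSetoid G F)
    (Quotient.out_eq (s := diagonalSetoid G F) (HomotopyQuotient.mk (e, x))).symm
  rw [HomotopyQuotient.coord, ha, MilnorE.coord_rmul h, mul_smul, smul_inv_smul]

/-- The transition function `[e] ↦ g n e * (g m e)⁻¹` over `{t n > 0} ∩ {t m > 0}`. -/
noncomputable def MilnorB.transition (n m : ℕ) (b : MilnorB G) : G :=
  MilnorE.coord n b.rep * (MilnorE.coord m b.rep)⁻¹

theorem MilnorB.transition_mk {n m : ℕ} {e : MilnorE G} (hn : 0 < e.t n) (hm : 0 < e.t m) :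
    MilnorB.transition n m (MilnorB.mk e) =
      MilnorE.coord n e * (MilnorE.coord m e)⁻¹ := by
  obtain ⟨a, ha⟩ := MilnorB.exists_of_mk_eq (MilnorB.mk_rep (MilnorB.mk e)).symm
  rw [MilnorB.transition, ha, MilnorE.coord_rmul hn, MilnorE.coord_rmul hm]
  group

variable [TopologicalSpace G] [TopologicalSpace F]

theorem MilnorB.isQuotientMap_mk : IsQuotientMap (MilnorB.mk : MilnorE G → MilnorB G) :=
  isQuotientMap_quotient_mk'

theorem HomotopyQuotient.isQuotientMap_mk :
    IsQuotientMap (HomotopyQuotient.mk : MilnorE G × F → HomotopyQuotient G F) :=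
  isQuotientMap_quotient_mk'

theorem HomotopyQuotient.continuous_proj : Continuous (HomotopyQuotient.proj G F) :=
  HomotopyQuotient.isQuotientMap_mk.continuous_iff.2
    (MilnorB.isQuotientMap_mk.continuous.comp continuous_fst)

theorem MilnorB.continuous_t (n : ℕ) : Continuous (MilnorB.t n : MilnorB G → ℝ) :=
  MilnorB.isQuotientMap_mk.continuous_iff.2 (MilnorE.continuous_t n)

theorem MilnorB.isOpen_pos (n : ℕ) : IsOpen {b : MilnorB G | 0 < MilnorB.t n b} :=
  isOpen_lt continuous_const (MilnorB.continuous_t n)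

theorem MilnorB.continuousOn_transition [IsTopologicalGroup G] (n m : ℕ) :
    ContinuousOn (MilnorB.transition n m : MilnorB G → G)
      ({b | 0 < MilnorB.t n b} ∩ {b | 0 < MilnorB.t m b}) := by
  refine (MilnorB.isQuotientMap_mk.continuousOn_isOpen_iff
    (g := (MilnorB.transition n m : MilnorB G → G))
    ((MilnorB.isOpen_pos n).inter (MilnorB.isOpen_pos m))).2 ?_
  intro e he
  have h1 : ContinuousWithinAt (fun e : MilnorE G => MilnorE.coord n e * (MilnorE.coord m e)⁻¹)
      (MilnorB.mk ⁻¹' ({b | 0 < MilnorB.t n b} ∩ {b | 0 < MilnorB.t m b})) e :=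
    ((MilnorE.continuousAt_coord he.1).mul
      (MilnorE.continuousAt_coord he.2).inv).continuousWithinAt
  exact h1.congr (fun e' he' => MilnorB.transition_mk he'.1 he'.2)
    (MilnorB.transition_mk he.1 he.2)

theorem MilnorB.continuousOn_sec [IsTopologicalGroup G] (n : ℕ) :
    ContinuousOn (MilnorB.sec n : MilnorB G → MilnorE G) {b | 0 < MilnorB.t n b} := by
  refine (MilnorB.isQuotientMap_mk.continuousOn_isOpen_iff
    (g := (MilnorB.sec n : MilnorB G → MilnorE G))
    (MilnorB.isOpen_pos n)).2 ?_
  have h1 : ContinuousOn (fun e : MilnorE G => e.rmul (MilnorE.coord n e)⁻¹)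
      (MilnorB.mk ⁻¹' {b | 0 < MilnorB.t n b}) :=
    MilnorE.continuousOn_rmul fun e he =>
      (MilnorE.continuousAt_coord he).inv.continuousWithinAt
  exact h1.congr fun e he => MilnorB.sec_mk he

theorem HomotopyQuotient.continuousOn_coord [ContinuousSMul G F] (n : ℕ) :
    ContinuousOn (HomotopyQuotient.coord n : HomotopyQuotient G F → F)
      (HomotopyQuotient.proj G F ⁻¹' {b | 0 < MilnorB.t n b}) := by
  refine (HomotopyQuotient.isQuotientMap_mk.continuousOn_isOpen_iff
    (g := (HomotopyQuotient.coord n : HomotopyQuotient G F → F))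
    ((MilnorB.isOpen_pos n).preimage HomotopyQuotient.continuous_proj)).2 ?_
  intro p hp
  have hp' : 0 < p.1.t n := hp
  have h1 : ContinuousAt (fun p : MilnorE G × F => MilnorE.coord n p.1 • p.2) p :=
    (ContinuousAt.comp (f := Prod.fst) (MilnorE.continuousAt_coord hp')
      continuous_fst.continuousAt).smul continuous_snd.continuousAt
  exact h1.continuousWithinAt.congr (fun q hq => HomotopyQuotient.coord_mk hq q.2)
    (HomotopyQuotient.coord_mk hp' p.2)

/-- The local trivialization `[e, x] ↦ ([e], g n e • x)` of `F_G → BG` over `{t n > 0}`. -/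
noncomputable def HomotopyQuotient.triv (G : Type u) [Group G] [TopologicalSpace G]
    [IsTopologicalGroup G] (F : Type v) [TopologicalSpace F] [MulAction G F] [ContinuousSMul G F]
    (n : ℕ) : Bundle.Trivialization F (HomotopyQuotient.proj G F) :=
  mkTrivialization HomotopyQuotient.continuous_proj {b | 0 < MilnorB.t n b}
    (MilnorB.isOpen_pos n) (HomotopyQuotient.coord n) (HomotopyQuotient.continuousOn_coord n)
    (fun q => HomotopyQuotient.mk (MilnorB.sec n q.1, q.2))
    (HomotopyQuotient.isQuotientMap_mk.continuous.comp_continuousOn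
      (((MilnorB.continuousOn_sec n).comp continuousOn_fst fun _ hq => hq.1).prodMk
        continuousOn_snd))
    (fun b _ _ => (MilnorB.mk_rmul _ _).trans b.mk_rep)
    (fun b hb a => by
      obtain ⟨e, rfl⟩ := MilnorB.isQuotientMap_mk.surjective b
      have he : 0 < e.t n := hb
      rw [MilnorB.sec_mk he, HomotopyQuotient.mk_rmul, HomotopyQuotient.coord_mk he,
        smul_inv_smul])
    (fun p hp => by
      obtain ⟨⟨e, a⟩, rfl⟩ := HomotopyQuotient.isQuotientMap_mk.surjective p
      have he : 0 < e.t n := hp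
      change HomotopyQuotient.mk (MilnorB.sec n (MilnorB.mk e), HomotopyQuotient.coord n
        (HomotopyQuotient.mk (e, a))) = HomotopyQuotient.mk (e, a)
      rw [MilnorB.sec_mk he, HomotopyQuotient.mk_rmul, HomotopyQuotient.coord_mk he,
        inv_smul_smul])

end

/-- The homotopy quotient `F_G → BG` as a fiber bundle with fiber `F` and structure group `G`,
the bundle associated to the principal bundle `EG → BG`. -/
noncomputable def homotopyQuotientBundle (G : Type u) [Group G] [TopologicalSpace G]
    [IsTopologicalGroup G] (F : Type v) [TopologicalSpace F] [MulAction G F]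
    [ContinuousSMul G F] : GBundle.{u, v, 0} G F (HomotopyQuotient.proj G F) where
  ι := ℕ
  triv := HomotopyQuotient.triv G F
  cover b := by
    obtain ⟨e, rfl⟩ := MilnorB.isQuotientMap_mk.surjective b
    exact e.exists_pos
  g := MilnorB.transition
  continuousOn_g := MilnorB.continuousOn_transition
  cocycle i j k b hb := by
    obtain ⟨e, rfl⟩ := MilnorB.isQuotientMap_mk.surjective b
    have hi : 0 < e.t i := hb.1.1
    have hj : 0 < e.t j := hb.1.2
    have hk : 0 < e.t k := hb.2
    rw [MilnorB.transition_mk hi hj, MilnorB.transition_mk hj hk, MilnorB.transition_mk hi hk]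
    group
  triv_eq i j p hp := by
    obtain ⟨⟨e, a⟩, rfl⟩ := HomotopyQuotient.isQuotientMap_mk.surjective p
    have hi : 0 < e.t i := hp.1
    have hj : 0 < e.t j := hp.2
    change HomotopyQuotient.coord i (HomotopyQuotient.mk (e, a)) =
      MilnorB.transition i j (MilnorB.mk e) •
        HomotopyQuotient.coord j (HomotopyQuotient.mk (e, a))
    rw [HomotopyQuotient.coord_mk hi, HomotopyQuotient.coord_mk hj, MilnorB.transition_mk hi hj,
      smul_smul]
    group

/-! ### Partitions of unity -/

/-! The argument is about cocycles. An isomorphism of `G`-bundles with fiber `F` amounts to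
coordinate transformations compatible with both cocycles: they determine the map on total spaces,
and they invert and compose (`CoordChange`, `toIso`). It is therefore enough to produce such
transformations, and the fiber enters only through the action of `G`.

For the classifying map, a partition of unity subordinate to a trivializing cover is first made
countable, since points of `EG` have coordinates indexed by `ℕ`. In `exists_countable`, the `n`-th
new function lives on disjoint open pieces, one for each set of `n + 1` old indices; each piece lies
in a single chart, called `c n`. Over a chart `i`, the point with weights `τ n` and group
coordinates `g (c n) i` is a lift to `EG`. By the cocycle condition, changing `i` multiplies it on
the right by an element of `G`, so the lifts define one map to `BG`. The transition functions of
`F_G` pull back along it to `g (c n) i * (g (c k) i)⁻¹`, so the elements `g (c n) i` are the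
required coordinate transformations.

Numerability of `F_G` itself needs an argument because the barycentric coordinates on `BG` are only
pointwise finite. Comparing each with their supremum gives a locally finite refinement
(`exists_isSubordinate_of_pointFinite`). -/

/-- A locally finite family of nonnegative continuous functions without common zeros can be
normalized to a partition of unity. -/
theorem PartitionOfUnity.exists_of_locallyFinite {κ : Type*} {X : Type*} [TopologicalSpace X]
    (v : κ → X → ℝ) (hv : ∀ k, Continuous (v k)) (h0 : ∀ k x, 0 ≤ v k x)
    (hfin : LocallyFinite fun k => Function.support (v k)) (hpos : ∀ x, ∃ k, 0 < v k x) :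
    ∃ τ : PartitionOfUnity κ X, ∀ k, Function.support (τ k) = Function.support (v k) := by
  have hσ : Continuous fun x => ∑ᶠ k, v k x := continuous_finsum hv hfin
  have hσpos : ∀ x, 0 < ∑ᶠ k, v k x := fun x =>
    finsum_pos (fun k => h0 k x) (hpos x) (hfin.point_finite x)
  have hsum : ∀ x, ∑ᶠ k, v k x / (∑ᶠ j, v j x) = 1 := fun x => by
    simp only [div_eq_mul_inv]
    rw [← finsum_mul, mul_inv_cancel₀ (hσpos x).ne']
  have hsupp : ∀ k, Function.support (fun x => v k x / ∑ᶠ j, v j x) =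
      Function.support (v k) := fun k => by
    ext x
    simp [(hσpos x).ne']
  refine ⟨⟨fun k => ⟨fun x => v k x / ∑ᶠ j, v j x, (hv k).div hσ fun x => (hσpos x).ne'⟩,
    ?_, fun k x => div_nonneg (h0 k x) (hσpos x).le, fun x _ => hsum x,
    fun x => (hsum x).le⟩, hsupp⟩
  exact hfin.subset fun k => (hsupp k).le

/-- A pointwise finite family of nonnegative continuous functions of sum `1` can be refined to
a locally finite partition of unity. -/
theorem PartitionOfUnity.exists_isSubordinate_of_pointFinite {κ : Type*} {X : Type*}
    [TopologicalSpace X] (t : κ → X → ℝ) (ht : ∀ k, Continuous (t k)) (h0 : ∀ k x, 0 ≤ t k x)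
    (hfin : ∀ x, (Function.support fun k => t k x).Finite) (hsum : ∀ x, ∑ᶠ k, t k x = 1) :
    ∃ ρ : PartitionOfUnity κ X, ρ.IsSubordinate fun k => {x | 0 < t k x} := by
  have hle : ∀ (J : Finset κ) x k, k ∉ J → t k x ≤ 1 - ∑ j ∈ J, t j x := by
    classical
    intro J x k hk
    have h1 : ∑ j ∈ insert k J, t j x ≤ ∑ᶠ j, t j x := by
      rw [finsum_eq_sum_of_support_subset (s := insert k J ∪ (hfin x).toFinset)]
      · exact Finset.sum_le_sum_of_subset_of_nonneg Finset.subset_union_left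
          fun j _ _ => h0 j x
      · intro j hj
        simp only [Finset.coe_union, Set.Finite.coe_toFinset]
        exact Or.inr hj
    rw [hsum, Finset.sum_insert hk] at h1
    linarith
  have hpos : ∀ x, ∃ k, 0 < t k x := by
    intro x
    by_contra! hc
    have : ∀ k, t k x = 0 := fun k => le_antisymm (hc k) (h0 k x)
    have h1 := hsum x
    simp [this] at h1
  -- Take `J` to be the functions nonzero at `x`, and `k` one that is positive there. The total
  -- weight outside `J` is continuous and vanishes at `x`, so near `x` it stays below half of `t k`
  -- and bounds every `t j` with `j ∉ J` at once.
  have hloc : ∀ x, ∃ (J : Finset κ) (k : κ), ∀ᶠ y in 𝓝 x, ∀ j ∉ J, 2 * t j y < t k y := by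
    intro x
    obtain ⟨k, hk⟩ := hpos x
    refine ⟨(hfin x).toFinset, k, ?_⟩
    have h1 : ∑ j ∈ (hfin x).toFinset, t j x = 1 := by
      rw [← hsum x, finsum_eq_sum _ (hfin x)]
    have h2 : ContinuousAt (fun y => t k y - 2 * (1 - ∑ j ∈ (hfin x).toFinset, t j y)) x :=
      ((ht k).sub (continuous_const.mul (continuous_const.sub
        (continuous_finsetSum _ fun j _ => ht j)))).continuousAt
    have h3 : 0 < t k x - 2 * (1 - ∑ j ∈ (hfin x).toFinset, t j x) := by
      rw [h1]; linarith
    filter_upwards [h2.eventually (lt_mem_nhds h3)] with y hy j hj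
    have := hle _ y j hj
    linarith
  have hbdd : ∀ x, BddAbove (range fun k => t k x) := fun x =>
    ⟨1, by
      rintro _ ⟨k, rfl⟩
      have := hle ∅ x k (Finset.notMem_empty k)
      simpa using this⟩
  have hleμ : ∀ x k, t k x ≤ ⨆ j, t j x := fun x k => le_ciSup (hbdd x) k
  have hμpos : ∀ x, 0 < ⨆ j, t j x := fun x => by
    obtain ⟨k, hk⟩ := hpos x
    exact hk.trans_le (hleμ x k)
  -- Near each point the supremum is a maximum over the finite set `J`, because functions outside
  -- `J` are dominated by `t k`.
  have hμ : Continuous fun x => ⨆ j, t j x := by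
    refine continuous_iff_continuousAt.2 fun x => ?_
    obtain ⟨J, k, hJ⟩ := hloc x
    -- Otherwise the estimate for `j = k` would read `2 * t k x < t k x`.
    have hkJ : k ∈ J := by
      by_contra hk
      have h1 := hJ.self_of_nhds k hk
      have h2 := h0 k x
      linarith
    have hne : J.Nonempty := ⟨k, hkJ⟩
    refine ContinuousAt.congr (f := fun y => J.sup' hne fun j => t j y)
      (Continuous.finset_sup'_apply hne fun j _ => ht j).continuousAt ?_
    filter_upwards [hJ] with y hy
    have : Nonempty κ := ⟨k⟩
    refine le_antisymm (Finset.sup'_le _ _ fun j _ => hleμ y j) (ciSup_le fun j => ?_)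
    by_cases hj : j ∈ J
    · exact Finset.le_sup' (fun j => t j y) hj
    · have h1 := hy j hj
      have h2 := h0 j y
      exact (by linarith : t j y ≤ t k y).trans (Finset.le_sup' (fun j => t j y) hkJ)
  -- Keep only what exceeds half the supremum. Functions outside `J` then vanish near `x`, and some
  -- function always survives because the supremum is positive.
  obtain ⟨ρ, hρ⟩ := PartitionOfUnity.exists_of_locallyFinite
    (fun k x => max 0 (2 * t k x - ⨆ j, t j x))
    (fun k => continuous_const.max ((continuous_const.mul (ht k)).sub hμ))
    (fun k x => le_max_left _ _)
    (fun x => by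
      obtain ⟨J, k, hJ⟩ := hloc x
      refine ⟨_, hJ, J.finite_toSet.subset ?_⟩
      rintro j ⟨y, hy, hyJ⟩
      by_contra hj
      refine hy (max_eq_left ?_)
      have h1 := hyJ j hj
      have h2 := hleμ y k
      linarith)
    (fun x => by
      obtain ⟨k₀, -⟩ := hpos x
      have : Nonempty κ := ⟨k₀⟩
      obtain ⟨k, hk⟩ := exists_lt_of_lt_ciSup
        (show (⨆ j, t j x) / 2 < ⨆ j, t j x from half_lt_self (hμpos x))
      exact ⟨k, lt_max_of_lt_right (by linarith)⟩)
  refine ⟨ρ, fun k => ?_⟩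
  -- The closed support must lie in `{t k > 0}`: this closed set contains the support, and on it `t
  -- k` is at least half a positive number.
  have hclosed : IsClosed {x | (⨆ j, t j x) ≤ 2 * t k x} :=
    isClosed_le hμ (continuous_const.mul (ht k))
  refine (closure_minimal ?_ hclosed).trans fun x hx => ?_
  · rw [hρ]
    intro x hx
    by_contra hc
    have h2 : 2 * t k x < ⨆ j, t j x := not_le.1 hc
    exact hx (max_eq_left (by linarith))
  · have h1 := hμpos x
    have h2 : (⨆ j, t j x) ≤ 2 * t k x := hx
    change 0 < t k x
    linarith

/-! ### Reduction to a countable partition of unity -/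

namespace PartitionOfUnity

variable {ι : Type*} {X : Type*} [TopologicalSpace X]

/-- A function that is positive exactly where every `ρ i`, `i ∈ S`, exceeds the sum of all the
`ρ j`, `j ∉ S`. -/
noncomputable def dominance (ρ : PartitionOfUnity ι X) (S : Finset ι) (x : X) : ℝ :=
  ∏ i ∈ S, max 0 (ρ i x - (1 - ∑ j ∈ S, ρ j x))

variable (ρ : PartitionOfUnity ι X)

theorem continuous_dominance (S : Finset ι) : Continuous (ρ.dominance S) :=
  continuous_finsetProd _ fun i _ => continuous_const.max
    ((ρ i).continuous.sub (continuous_const.sub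
      (continuous_finsetSum _ fun j _ => (ρ j).continuous)))

theorem dominance_nonneg (S : Finset ι) (x : X) : 0 ≤ ρ.dominance S x :=
  Finset.prod_nonneg fun _ _ => le_max_left _ _

theorem lt_of_dominance_ne_zero {S : Finset ι} {x : X} (h : ρ.dominance S x ≠ 0) {i : ι}
    (hi : i ∈ S) : 1 - ∑ j ∈ S, ρ j x < ρ i x := by
  have h1 := Finset.prod_ne_zero_iff.1 h i hi
  by_contra hc
  exact h1 (max_eq_left (by linarith))

/-- The right-hand side is the total weight outside `S`, of which `ρ k x` is one nonnegative term.
-/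
theorem le_one_sub_sum {S : Finset ι} {x : X} {k : ι} (hk : k ∉ S) :
    ρ k x ≤ 1 - ∑ j ∈ S, ρ j x := by
  classical
  have h1 := ρ.sum_finsupport' (mem_univ x)
    (I := insert k S ∪ ρ.finsupport x) Finset.subset_union_right
  have h2 : ∑ j ∈ insert k S, ρ j x ≤ 1 := h1 ▸ Finset.sum_le_sum_of_subset_of_nonneg
    Finset.subset_union_left fun j _ _ => ρ.nonneg j x
  rw [Finset.sum_insert hk] at h2
  linarith

theorem pos_of_dominance_ne_zero {S : Finset ι} {x : X} (h : ρ.dominance S x ≠ 0) {i : ι}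
    (hi : i ∈ S) : 0 < ρ i x := by
  classical
  have h1 : ∑ j ∈ S, ρ j x ≤ 1 := by
    rw [← ρ.sum_finsupport' (mem_univ x) (I := S ∪ ρ.finsupport x) Finset.subset_union_right]
    exact Finset.sum_le_sum_of_subset_of_nonneg Finset.subset_union_left
      fun j _ _ => ρ.nonneg j x
  have := ρ.lt_of_dominance_ne_zero h hi
  linarith

/-- Distinct sets of equal size have some `i ∈ S \ T` and `j ∈ T \ S`. Dominance of `S` forces `ρ j
x < ρ i x`, that of `T` the reverse. Hence the pieces for a fixed cardinality are disjoint. -/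
theorem eq_of_dominance_ne_zero {S T : Finset ι} (hST : S.card = T.card) {x : X}
    (hS : ρ.dominance S x ≠ 0) (hT : ρ.dominance T x ≠ 0) : S = T := by
  by_contra hne
  have h1 : ¬S ⊆ T := fun h => hne (Finset.eq_of_subset_of_card_le h hST.ge)
  have h2 : ¬T ⊆ S := fun h => hne (Finset.eq_of_subset_of_card_le h hST.le).symm
  obtain ⟨i, hiS, hiT⟩ := Finset.not_subset.1 h1
  obtain ⟨j, hjT, hjS⟩ := Finset.not_subset.1 h2
  have a1 := ρ.lt_of_dominance_ne_zero hS hiS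
  have a2 := ρ.lt_of_dominance_ne_zero hT hjT
  have a3 := ρ.le_one_sub_sum (x := x) hiT
  have a4 := ρ.le_one_sub_sum (x := x) hjS
  linarith

/-- From any partition of unity one obtains a countable one, such that on the set
`{τ n > 0}` one may choose, in a locally constant way, a function of the given partition that
is positive. -/
theorem exists_countable :
    ∃ (τ : PartitionOfUnity ℕ X) (c : ℕ → X → ι), ∀ n x, 0 < τ n x →
      0 < ρ (c n x) x ∧ ∀ᶠ y in 𝓝 x, c n y = c n x := by
  classical
  -- A point of `X` is needed only to supply the default index `i₀`; over an empty space `ι` may be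
  -- empty.
  rcases isEmpty_or_nonempty X with hX | ⟨⟨x₀⟩⟩
  · exact ⟨⟨fun _ => 0, fun x => hX.elim x, fun _ x => hX.elim x, fun x => hX.elim x,
      fun x => hX.elim x⟩, fun _ x => hX.elim x, fun _ x => hX.elim x⟩
  obtain ⟨i₀, -⟩ := ρ.exists_pos (mem_univ x₀)
  -- The shift by one excludes the empty set, whose dominance is the empty product `1` and which has
  -- no index to pick.
  let K : ℕ → Type _ := fun n => {S : Finset ι // S.card = n + 1}
  have hmem : ∀ {n} (S : K n) {W : Set X}, (Function.support (ρ.dominance S.1) ∩ W).Nonempty →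
      ∀ i ∈ S.1, (Function.support (ρ i) ∩ W).Nonempty := by
    rintro n S W ⟨y, hy, hyW⟩ i hi
    exact ⟨y, (ρ.pos_of_dominance_ne_zero hy hi).ne', hyW⟩
  have hKfin : ∀ n, LocallyFinite fun S : K n => Function.support (ρ.dominance S.1) := by
    intro n x
    obtain ⟨W, hW, hWf⟩ := ρ.locallyFinite x
    refine ⟨W, hW, Set.Finite.subset (s := (fun S : K n => S.1) ⁻¹'
      (hWf.toFinset.powerset : Set (Finset ι)))
      ((Finset.finite_toSet _).preimage Subtype.val_injective.injOn) fun S hS => ?_⟩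
    simp only [mem_preimage, Finset.mem_coe, Finset.mem_powerset]
    exact fun i hi => hWf.mem_toFinset.2 (hmem S hS i hi)
  let v : ℕ → X → ℝ := fun n x => ∑ᶠ S : K n, ρ.dominance S.1 x
  have hv0 : ∀ n x, v n x ≠ 0 → ∃ S : K n, ρ.dominance S.1 x ≠ 0 := by
    intro n x h
    by_contra! hc
    exact h (by simp [v, hc])
  obtain ⟨τ, hτ⟩ := PartitionOfUnity.exists_of_locallyFinite v
    (fun n => continuous_finsum (fun S => ρ.continuous_dominance S.1) (hKfin n))
    (fun n x => finsum_nonneg fun S => ρ.dominance_nonneg S.1 x)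
    (fun x => by
      obtain ⟨W, hW, hWf⟩ := ρ.locallyFinite x
      -- Only finitely many `ρ i` meet `W`; a set `S` contributing there consists of such indices,
      -- which bounds `n + 1` by their number.
      refine ⟨W, hW, (Set.finite_lt_nat hWf.toFinset.card).subset ?_⟩
      rintro n ⟨y, hy, hyW⟩
      obtain ⟨S, hS⟩ := hv0 n y hy
      have h1 : S.1 ⊆ hWf.toFinset := fun i hi =>
        hWf.mem_toFinset.2 (hmem S ⟨y, hS, hyW⟩ i hi)
      have h2 := Finset.card_le_card h1
      rw [S.2] at h2
      exact h2)
    (fun x => by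
      obtain ⟨i, hi⟩ := ρ.exists_pos (mem_univ x)
      have hne : (ρ.finsupport x).Nonempty := ⟨i, (ρ.mem_finsupport x).2 hi.ne'⟩
      obtain ⟨n, hn⟩ := Nat.exists_eq_succ_of_ne_zero hne.card_pos.ne'
      -- The set of all indices active at `x` leaves no weight outside, so each factor of its
      -- dominance is just `ρ j x > 0`.
      refine ⟨n, finsum_pos (fun S => ρ.dominance_nonneg S.1 x) ⟨⟨ρ.finsupport x, hn⟩, ?_⟩
        ((hKfin n).point_finite x)⟩
      refine Finset.prod_pos fun j hj => lt_max_of_lt_right ?_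
      rw [ρ.sum_finsupport (mem_univ x), sub_self, sub_zero]
      exact lt_of_le_of_ne (ρ.nonneg j x) (Ne.symm ((ρ.mem_finsupport x).1 hj)))
  let pick : Finset ι → ι := fun S => if h : S.Nonempty then h.choose else i₀
  have hpick : ∀ {n} (S : K n), pick S.1 ∈ S.1 := by
    intro n S
    have h : S.1.Nonempty := Finset.card_pos.1 (by rw [S.2]; exact n.succ_pos)
    simp only [pick, h, dif_pos]
    exact h.choose_spec
  let c : ℕ → X → ι := fun n x =>
    if h : ∃ S : K n, ρ.dominance S.1 x ≠ 0 then pick h.choose.1 else i₀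
  have hc : ∀ {n} (S : K n) {x}, ρ.dominance S.1 x ≠ 0 → c n x = pick S.1 := by
    intro n S x hS
    have h : ∃ S : K n, ρ.dominance S.1 x ≠ 0 := ⟨S, hS⟩
    simp only [c, h, dif_pos]
    rw [ρ.eq_of_dominance_ne_zero (h.choose.2.trans S.2.symm) h.choose_spec hS]
  refine ⟨τ, c, fun n x hx => ?_⟩
  have hvx : x ∈ Function.support (v n) := hτ n ▸ (show x ∈ Function.support (τ n) from hx.ne')
  obtain ⟨S, hS⟩ := hv0 n x hvx
  rw [hc S hS]
  refine ⟨ρ.pos_of_dominance_ne_zero hS (hpick S), ?_⟩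
  -- The same `S` dominates on a neighborhood, and by uniqueness it determines `c n` there.
  filter_upwards [(ρ.continuous_dominance S.1).continuousAt.eventually_ne hS] with y hy
  exact hc S hy

end PartitionOfUnity

/-! ### Isomorphisms from coordinate transformations -/

namespace GBundle

section

variable {G : Type u} [Group G] [TopologicalSpace G] {F : Type v} [TopologicalSpace F]
  [MulAction G F] {E : Type z} [TopologicalSpace E] {M : Type x} [TopologicalSpace M] {f : E → M}
  {E' : Type z'} [TopologicalSpace E'] {f' : E' → M}

/-- The coordinate transformations of an isomorphism of bundles with structure group `G`. -/
structure CoordChange (B : GBundle.{u, v, w} G F f) (B' : GBundle.{u, v, w'} G F f') where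
  coord : B'.ι → B.ι → M → G
  continuousOn_coord : ∀ a i,
    ContinuousOn (coord a i) ((B'.triv a).baseSet ∩ (B.triv i).baseSet)
  coord_mul : ∀ a i j,
    ∀ m ∈ (B'.triv a).baseSet ∩ (B.triv i).baseSet ∩ (B.triv j).baseSet,
      coord a i m * B.g i j m = coord a j m
  mul_coord : ∀ a b i,
    ∀ m ∈ (B'.triv a).baseSet ∩ (B'.triv b).baseSet ∩ (B.triv i).baseSet,
      B'.g a b m * coord b i m = coord a i m

theorem eq_of_triv_eq (B : GBundle.{u, v, w} G F f) {p q : E} (hpq : f p = f q) {i : B.ι}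
    (hi : f p ∈ (B.triv i).baseSet) (h : (B.triv i p).2 = (B.triv i q).2) : p = q := by
  have hp : p ∈ (B.triv i).source := (B.triv i).mem_source.2 hi
  have hq : q ∈ (B.triv i).source := (B.triv i).mem_source.2 (hpq ▸ hi)
  rw [← (B.triv i).symm_apply_mk_proj hp, ← (B.triv i).symm_apply_mk_proj hq, hpq, h]

theorem continuous_proj (B : GBundle.{u, v, w} G F f) : Continuous f := by
  refine continuous_iff_continuousAt.2 fun p => ?_
  obtain ⟨i, hi⟩ := B.cover (f p)
  exact (B.triv i).continuousAt_proj ((B.triv i).mem_source.2 hi)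

namespace CoordChange

/-- The coordinate transformations of the identity. -/
def refl (B : GBundle.{u, v, w} G F f) : CoordChange B B where
  coord := B.g
  continuousOn_coord := B.continuousOn_g
  coord_mul := B.cocycle
  mul_coord := B.cocycle

variable {B : GBundle.{u, v, w} G F f} {B' : GBundle.{u, v, w'} G F f'}

/-- The coordinate transformations of the inverse isomorphism. -/
def symm [IsTopologicalGroup G] (c : CoordChange B B') : CoordChange B' B where
  coord i a m := (c.coord a i m)⁻¹
  continuousOn_coord i a := by
    rw [inter_comm]
    exact (c.continuousOn_coord a i).inv
  coord_mul i a b m hm := by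
    rw [← c.mul_coord a b i m ⟨⟨hm.1.2, hm.2⟩, hm.1.1⟩]
    group
  mul_coord i j a m hm := by
    rw [← c.coord_mul a i j m ⟨⟨hm.2, hm.1.1⟩, hm.1.2⟩]
    group

/-- The coordinate transformations of a composition. -/
noncomputable def trans [IsTopologicalGroup G] {E'' : Type*} [TopologicalSpace E'']
    {f'' : E'' → M} {B'' : GBundle G F f''} (c : CoordChange B B') (c' : CoordChange B' B'') :
    CoordChange B B'' := by
  -- The product does not depend on the intermediate chart, since `B'.g` cancels between the
  -- factors. Continuity can thus be checked with one chart fixed near the point, although the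
  -- chosen chart may jump.
  have key : ∀ d i m, m ∈ (B''.triv d).baseSet ∩ (B.triv i).baseSet →
      ∀ a, m ∈ (B'.triv a).baseSet →
      c'.coord d (B'.cover m).choose m * c.coord (B'.cover m).choose i m =
        c'.coord d a m * c.coord a i m := by
    intro d i m hm a ha
    have hb := (B'.cover m).choose_spec
    rw [← c'.coord_mul d a _ m ⟨⟨hm.1, ha⟩, hb⟩, mul_assoc,
      c.mul_coord a _ i m ⟨⟨ha, hb⟩, hm.2⟩]
  exact
  { coord := fun d i m => c'.coord d (B'.cover m).choose m * c.coord (B'.cover m).choose i m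
    continuousOn_coord := fun d i m hm => by
      obtain ⟨a, ha⟩ := B'.cover m
      have hd : (B''.triv d).baseSet ∈ 𝓝 m := (B''.triv d).open_baseSet.mem_nhds hm.1
      have hi : (B.triv i).baseSet ∈ 𝓝 m := (B.triv i).open_baseSet.mem_nhds hm.2
      have ha' : (B'.triv a).baseSet ∈ 𝓝 m := (B'.triv a).open_baseSet.mem_nhds ha
      have h1 := ((c'.continuousOn_coord d a).continuousAt (Filter.inter_mem hd ha')).mul
        ((c.continuousOn_coord a i).continuousAt (Filter.inter_mem ha' hi))
      refine (h1.congr ?_).continuousWithinAt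
      filter_upwards [hd, hi, ha'] with m' h1 h2 h3
      exact (key d i m' ⟨h1, h2⟩ a h3).symm
    coord_mul := fun d i j m hm => by
      have hb := (B'.cover m).choose_spec
      rw [mul_assoc, c.coord_mul _ i j m ⟨⟨hb, hm.1.2⟩, hm.2⟩]
    mul_coord := fun d e i m hm => by
      have hb := (B'.cover m).choose_spec
      rw [← mul_assoc, c'.mul_coord d e _ m ⟨hm.1, hb⟩] }

/-- The formula in one pair of charts defines `q`; the two compatibility relations carry it over to
every other pair. -/
theorem exists_image (c : CoordChange B B') (p : E) : ∃ q : E', f' q = f p ∧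
    ∀ a i, f p ∈ (B'.triv a).baseSet ∩ (B.triv i).baseSet →
      (B'.triv a q).2 = c.coord a i (f p) • (B.triv i p).2 := by
  obtain ⟨b, hb⟩ := B'.cover (f p)
  obtain ⟨j, hj⟩ := B.cover (f p)
  refine ⟨(B'.triv b).toOpenPartialHomeomorph.symm (f p, c.coord b j (f p) • (B.triv j p).2),
    (B'.triv b).proj_symm_apply' hb, fun a i h => ?_⟩
  have hq := (B'.triv b).proj_symm_apply' hb (x := c.coord b j (f p) • (B.triv j p).2)
  rw [B'.triv_eq a b _ (by rw [hq]; exact ⟨h.1, hb⟩), hq, (B'.triv b).apply_symm_apply' hb,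
    B.triv_eq j i p ⟨hj, h.2⟩, smul_smul, smul_smul, mul_assoc,
    c.coord_mul b j i (f p) ⟨⟨hb, hj⟩, h.2⟩, c.mul_coord a b i (f p) ⟨⟨h.1, hb⟩, h.2⟩]

/-- The map of total spaces with given coordinate transformations. -/
noncomputable def map (c : CoordChange B B') (p : E) : E' :=
  (c.exists_image p).choose

theorem proj_map (c : CoordChange B B') (p : E) : f' (c.map p) = f p :=
  (c.exists_image p).choose_spec.1

theorem triv_map (c : CoordChange B B') {a : B'.ι} {i : B.ι} {p : E}
    (h : f p ∈ (B'.triv a).baseSet ∩ (B.triv i).baseSet) :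
    (B'.triv a (c.map p)).2 = c.coord a i (f p) • (B.triv i p).2 :=
  (c.exists_image p).choose_spec.2 a i h

theorem continuous_map [ContinuousSMul G F] (c : CoordChange B B') : Continuous c.map := by
  refine continuous_iff_continuousAt.2 fun p => ?_
  obtain ⟨a, ha⟩ := B'.cover (f p)
  obtain ⟨i, hi⟩ := B.cover (f p)
  have hf := B.continuous_proj.continuousAt (x := p)
  have ha' : (B'.triv a).baseSet ∈ 𝓝 (f p) := (B'.triv a).open_baseSet.mem_nhds ha
  have hi' : (B.triv i).baseSet ∈ 𝓝 (f p) := (B.triv i).open_baseSet.mem_nhds hi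
  have h1 : ContinuousAt (fun p => c.coord a i (f p) • (B.triv i p).2) p :=
    (((c.continuousOn_coord a i).continuousAt (Filter.inter_mem ha' hi')).comp hf).smul
      (continuous_snd.continuousAt.comp
        ((B.triv i).toOpenPartialHomeomorph.continuousAt ((B.triv i).mem_source.2 hi)))
  have h2 : ContinuousAt (fun p => (B'.triv a).toOpenPartialHomeomorph.symm
      (f p, c.coord a i (f p) • (B.triv i p).2)) p :=
    ContinuousAt.comp (f := fun p => (f p, c.coord a i (f p) • (B.triv i p).2))
      ((B'.triv a).toOpenPartialHomeomorph.continuousAt_symm ((B'.triv a).mem_target.2 ha))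
      (hf.prodMk h1)
  refine h2.congr ?_
  filter_upwards [hf ha', hf hi'] with q hqa hqi
  rw [← c.triv_map ⟨hqa, hqi⟩, ← c.proj_map q]
  exact (B'.triv a).symm_apply_mk_proj
    ((B'.triv a).mem_source.2 (by rw [c.proj_map]; exact hqa))

theorem map_symm_map [IsTopologicalGroup G] (c : CoordChange B B') (p : E) :
    c.symm.map (c.map p) = p := by
  obtain ⟨a, ha⟩ := B'.cover (f p)
  obtain ⟨i, hi⟩ := B.cover (f p)
  have h1 : f (c.symm.map (c.map p)) = f p := (c.symm.proj_map _).trans (c.proj_map p)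
  refine B.eq_of_triv_eq (i := i) h1 (by rw [h1]; exact hi) ?_
  rw [c.symm.triv_map (a := i) (i := a) (by rw [c.proj_map]; exact ⟨hi, ha⟩),
    c.triv_map ⟨ha, hi⟩, c.proj_map]
  exact inv_smul_smul _ _

theorem symm_symm [IsTopologicalGroup G] (c : CoordChange B B') : c.symm.symm = c := by
  cases c
  simp [symm]

/-- The isomorphism with given coordinate transformations. -/
noncomputable def toIso [IsTopologicalGroup G] [ContinuousSMul G F] (c : CoordChange B B') :
    B.Iso B' where
  toHomeomorph :=
    { toFun := c.map
      invFun := c.symm.map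
      left_inv := c.map_symm_map
      right_inv := fun p => by
        have := c.symm.map_symm_map p
        rwa [c.symm_symm] at this
      continuous_toFun := c.continuous_map
      continuous_invFun := c.symm.continuous_map }
  proj_eq := c.proj_map
  coord := c.coord
  continuousOn_coord := c.continuousOn_coord
  coord_mul := c.coord_mul
  mul_coord := c.mul_coord
  triv_eq _ _ _ h := c.triv_map h

end CoordChange

/-- The coordinate transformations of an isomorphism. -/
def Iso.toCoordChange {B : GBundle.{u, v, w} G F f} {B' : GBundle.{u, v, w'} G F f'}
    (φ : B.Iso B') : CoordChange B B' where
  coord := φ.coord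
  continuousOn_coord := φ.continuousOn_coord
  coord_mul := φ.coord_mul
  mul_coord := φ.mul_coord

end

end GBundle

/-! ### The homotopy quotient is numerable -/

/-- The charts lie over the sets `{t n > 0}`, so a locally finite refinement of the barycentric
coordinates is subordinate to them. -/
theorem homotopyQuotientBundle_hasPartition (G : Type u) [Group G] [TopologicalSpace G]
    [IsTopologicalGroup G] (F : Type v) [TopologicalSpace F] [MulAction G F]
    [ContinuousSMul G F] : (homotopyQuotientBundle G F).HasPartition := by
  refine PartitionOfUnity.exists_isSubordinate_of_pointFinite
    (fun n : ℕ => (MilnorB.t n : MilnorB G → ℝ)) MilnorB.continuous_t ?_ ?_ ?_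
  · intro n b
    obtain ⟨e, rfl⟩ := MilnorB.isQuotientMap_mk.surjective b
    exact e.t_nonneg n
  · intro b
    obtain ⟨e, rfl⟩ := MilnorB.isQuotientMap_mk.surjective b
    exact e.t_finite
  · intro b
    obtain ⟨e, rfl⟩ := MilnorB.isQuotientMap_mk.surjective b
    exact e.t_sum

/-! ### The classifying map -/

namespace GBundle

section

variable {G : Type u} [Group G] [TopologicalSpace G] {F : Type v} [TopologicalSpace F]
  [MulAction G F] {E : Type z} [TopologicalSpace E] {M : Type x} [TopologicalSpace M] {f : E → M}

/-- The lift to `EG`, over the base set of the `i`-th local trivialization, of the classifying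
map defined by a countable partition of unity `τ` and local trivializations `c n m` around `m`. -/
def classifyingLift (B : GBundle.{u, v, w} G F f) (τ : PartitionOfUnity ℕ M) (c : ℕ → M → B.ι)
    (i : B.ι) (m : M) : MilnorE G where
  t n := τ n m
  t_nonneg n := τ.nonneg n m
  t_finite := τ.locallyFinite.point_finite m
  t_sum := τ.sum_eq_one (mem_univ m)
  g n _ := B.g (c n m) i m

/-- The classifying map `M → BG`. -/
noncomputable def classifyingMap (B : GBundle.{u, v, w} G F f) (τ : PartitionOfUnity ℕ M)
    (c : ℕ → M → B.ι) (m : M) : MilnorB G :=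
  MilnorB.mk (B.classifyingLift τ c (B.cover m).choose m)

variable (B : GBundle.{u, v, w} G F f) {τ : PartitionOfUnity ℕ M} {c : ℕ → M → B.ι}

theorem coord_classifyingLift {n : ℕ} {m : M} (h : 0 < τ n m) (i : B.ι) :
    MilnorE.coord n (B.classifyingLift τ c i m) = B.g (c n m) i m :=
  MilnorE.coord_of_pos (e := B.classifyingLift τ c i m) h

/-- Where `τ n > 0` the chart `c n` is locally constant, so nearby this is a single transition
function. -/
theorem continuousAt_g_of_locallyConstant
    (hc : ∀ n m, 0 < τ n m → m ∈ (B.triv (c n m)).baseSet ∧ ∀ᶠ y in 𝓝 m, c n y = c n m)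
    {n : ℕ} {i : B.ι} {m : M} (hm : 0 < τ n m) (hi : m ∈ (B.triv i).baseSet) :
    ContinuousAt (fun m => B.g (c n m) i m) m := by
  have h1 : ContinuousAt (B.g (c n m) i) m := (B.continuousOn_g _ _).continuousAt
    (Filter.inter_mem ((B.triv _).open_baseSet.mem_nhds (hc n m hm).1)
      ((B.triv i).open_baseSet.mem_nhds hi))
  refine h1.congr ?_
  filter_upwards [(hc n m hm).2] with y hy
  rw [hy]

theorem continuousOn_classifyingLift
    (hc : ∀ n m, 0 < τ n m → m ∈ (B.triv (c n m)).baseSet ∧ ∀ᶠ y in 𝓝 m, c n y = c n m)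
    (i : B.ι) : ContinuousOn (B.classifyingLift τ c i) (B.triv i).baseSet := by
  refine continuousOn_to_generateFrom_iff.2 fun m hm T hT hmT => mem_nhdsWithin_of_mem_nhds ?_
  rcases hT with ⟨n, U, hU, rfl⟩ | ⟨n, V, hV, rfl⟩
  · exact (hU.preimage (τ n).continuous).mem_nhds hmT
  · obtain ⟨h, hmV⟩ := hmT
    have h0 : 0 < τ n m := h
    filter_upwards [(τ n).continuous.continuousAt.eventually (lt_mem_nhds h0),
      (B.continuousAt_g_of_locallyConstant hc h0 hm).eventually (hV.mem_nhds hmV)] with y hy hyV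
    exact ⟨hy, hyV⟩

/-- By the cocycle condition, lifts over charts `i` and `j` differ by right multiplication by `g i
j`. So the chosen chart is immaterial, and continuity follows from that of the lifts. -/
theorem classifyingMap_eq
    (hc : ∀ n m, 0 < τ n m → m ∈ (B.triv (c n m)).baseSet ∧ ∀ᶠ y in 𝓝 m, c n y = c n m)
    {i : B.ι} {m : M} (hi : m ∈ (B.triv i).baseSet) :
    B.classifyingMap τ c m = MilnorB.mk (B.classifyingLift τ c i m) := by
  have hj := (B.cover m).choose_spec
  have h1 : B.classifyingLift τ c (B.cover m).choose m =
      (B.classifyingLift τ c i m).rmul (B.g i (B.cover m).choose m) := by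
    unfold classifyingLift MilnorE.rmul
    congr 1
    funext n hn
    exact (B.cocycle _ _ _ m ⟨⟨(hc n m hn).1, hi⟩, hj⟩).symm
  rw [classifyingMap, h1, MilnorB.mk_rmul]

theorem continuous_classifyingMap
    (hc : ∀ n m, 0 < τ n m → m ∈ (B.triv (c n m)).baseSet ∧ ∀ᶠ y in 𝓝 m, c n y = c n m) :
    Continuous (B.classifyingMap τ c) := by
  refine continuous_iff_continuousAt.2 fun m => ?_
  obtain ⟨i, hi⟩ := B.cover m
  have hi' := (B.triv i).open_baseSet.mem_nhds hi
  refine ContinuousAt.congr (MilnorB.isQuotientMap_mk.continuous.continuousAt.comp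
    ((B.continuousOn_classifyingLift hc i).continuousAt hi')) ?_
  filter_upwards [hi'] with y hy
  exact (B.classifyingMap_eq hc hy).symm

theorem transition_classifyingMap_mul
    (hc : ∀ n m, 0 < τ n m → m ∈ (B.triv (c n m)).baseSet ∧ ∀ᶠ y in 𝓝 m, c n y = c n m)
    {n k : ℕ} {i : B.ι} {m : M} (hn : 0 < τ n m) (hk : 0 < τ k m)
    (hi : m ∈ (B.triv i).baseSet) :
    MilnorB.transition n k (B.classifyingMap τ c m) * B.g (c k m) i m = B.g (c n m) i m := by
  rw [B.classifyingMap_eq hc hi, MilnorB.transition_mk hn hk, B.coord_classifyingLift hn,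
    B.coord_classifyingLift hk, inv_mul_cancel_right]

/-- The coordinate transformations `g (c n m) i m` between a bundle and its pullback from
`F_G → BG` along the classifying map. -/
noncomputable def classifyingCoordChange [IsTopologicalGroup G] [ContinuousSMul G F]
    (hc : ∀ n m, 0 < τ n m → m ∈ (B.triv (c n m)).baseSet ∧ ∀ᶠ y in 𝓝 m, c n y = c n m) :
    CoordChange B ((homotopyQuotientBundle G F).pullback
      ⟨B.classifyingMap τ c, B.continuous_classifyingMap hc⟩) where
  coord n i m := B.g (c n m) i m
  -- The `n`-th chart of the pullback lies over `{τ n > 0}`, because `t n` of the classifying map is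
  -- `τ n` by definition.
  continuousOn_coord _ _ _ hm :=
    (B.continuousAt_g_of_locallyConstant hc hm.1 hm.2).continuousWithinAt
  coord_mul _ _ _ _ hm :=
    B.cocycle _ _ _ _ ⟨⟨(hc _ _ hm.1.1).1, hm.1.2⟩, hm.2⟩
  mul_coord _ _ _ _ hm :=
    B.transition_classifyingMap_mul hc hm.1.1 hm.1.2 hm.2

end

end GBundle

theorem theoremt
    (G : Type u) [Group G] [TopologicalSpace G] [IsTopologicalGroup G]
    (F : Type v) [TopologicalSpace F] [MulAction G F] [ContinuousSMul G F] :
    (homotopyQuotientBundle G F).IsNumerable ∧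
    ∀ {E : Type z} [TopologicalSpace E] {M : Type x} [TopologicalSpace M] (f : E → M)
      (B : GBundle.{u, v, w} G F f), B.IsNumerable →
      ∃ h : C(M, MilnorB G), Nonempty (B.Iso ((homotopyQuotientBundle G F).pullback h)) := by
  refine ⟨⟨_, ⟨(GBundle.CoordChange.refl _).toIso⟩, homotopyQuotientBundle_hasPartition G F⟩, ?_⟩
  rintro E _ M _ f B ⟨B', ⟨φ⟩, ρ, hρ⟩
  obtain ⟨τ, c, hτ⟩ := ρ.exists_countable
  have hc : ∀ n m, 0 < τ n m → m ∈ (B'.triv (c n m)).baseSet ∧ ∀ᶠ y in 𝓝 m, c n y = c n m :=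
    -- Subordination turns positivity of `ρ (c n m)` at `m` into membership of `m` in that chart's
    -- base set.
    fun n m hm => ⟨hρ _ (subset_closure (hτ n m hm).1.ne'), (hτ n m hm).2⟩
  exact ⟨_, ⟨(φ.toCoordChange.trans (B'.classifyingCoordChange hc)).toIso⟩⟩
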